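/- Let $\xi_1,\dots,\xi_n$ be independent Bernoulli random variables with $P(\xi_i=1)=1-P(\xi_i=0)=p_i\in[0,1]$, and put $W=\xi_1+\dots+\xi_n$, $\lambda=\sum_{i=1}^n p_i$, $\lambda_2=\sum_{i=1}^n p_i^2$. Let $\mathcal L(W)$ be the distribution of $W$ and $\Pi$ the Poisson distribution with parameter $\lambda$. For a signed measure $M$ on the nonnegative integers let $M(j)=\sum_{k=0}^{j}M\{k\}$, and let $\|M\|_W=\sum_{j=0}^\infty|M(j)|$ be its Wasserstein norm. (a) There is an absolute constant $C>0$ such that, whenever $\max_i p_i\le 1/20$ and $\lambda\ge 1$, the norm $\|\mathcal L(W)-\Pi\|_W$ is finite and $$\Bigl|\,\|\mathcal L(W)-\Pi\|_W-\frac{\lambda_2}{\sqrt{2\pi\lambda}}\Bigr|\le \frac{C\lambda_2}{\sqrt{\lambda}}\Bigl(\max_j p_j+\frac1{\sqrt\lambda}\Bigr).$$ (b) Consider a sequence of such sums: for each $n$, let $W_n$ be a sum of finitely many independent Bernoulli variables with success probabilities $p_{n,1},\dots,p_{n,N_n}$, and let $\lambda^{(n)}=\sum_i p_{n,i}$, $\lambda_2^{(n)}=\sum_i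 p_{n,i}^2$, with $\Pi^{(n)}$ the Poisson distribution with parameter $\lambda^{(n)}$. If $\max_i p_{n,i}\to0$ and $\lambda^{(n)}\to\infty$ as $n\to\infty$, then all the norms $\|\mathcal L(W_n)-\Pi^{(n)}\|_W$ are finite and $$\lim_{n\to\infty}\frac{\sqrt{\lambda^{(n)}}}{\lambda_2^{(n)}}\,\bigl\|\mathcal L(W_n)-\Pi^{(n)}\bigr\|_W=\frac1{\sqrt{2\pi}}.$$ Moreover, $1/\sqrt{2\pi}\le 0.399$. -/

import Mathlib

open MeasureTheory ProbabilityTheory Filter Topology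

/-- The value `M(x) = ∑_{k=0}^x M{k}` at `x` of the distribution function of a signed measure `M`
on the nonnegative integers. -/
noncomputable def signedCDF (M : SignedMeasure ℕ) (x : ℕ) : ℝ :=
  ∑ k ∈ Finset.range (x + 1), M {k}

/-- The Wasserstein norm of `M` is finite, that is, `∑_j |M(j)| < ∞`. -/
def FiniteWassersteinNorm (M : SignedMeasure ℕ) : Prop :=
  Summable fun j : ℕ => |signedCDF M j|

/-- The Wasserstein norm `‖M‖_W = ∑_{j=0}^∞ |M(j)|` of a signed measure on the nonnegative integers
(meaningful if `FiniteWassersteinNorm M`). -/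
noncomputable def wassersteinNorm (M : SignedMeasure ℕ) : ℝ :=
  ∑' j : ℕ, |signedCDF M j|

/-- `ξ` is a finite family of independent random variables on `(Ω, P)`, and `ξ i` is Bernoulli with
`P(ξ i = 1) = p i` and `P(ξ i = 0) = 1 - p i`. -/
structure IsIndepBernoulli {Ω : Type*} [MeasurableSpace Ω] (P : Measure Ω) {n : ℕ}
    (p : Fin n → unitInterval) (ξ : Fin n → Ω → ℕ) : Prop where
  indep : iIndepFun ξ P
  law : ∀ i, HasLaw (ξ i) (bernoulliMeasure (1 : ℕ) 0 (p i)) P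

/-- `λ = ∑ p_i`. -/
noncomputable def lam {n : ℕ} (p : Fin n → unitInterval) : ℝ := ∑ i, (p i : ℝ)

/-- `λ₂ = ∑ p_i²`. -/
noncomputable def lamTwo {n : ℕ} (p : Fin n → unitInterval) : ℝ := ∑ i, (p i : ℝ) ^ 2

/-- `max p_i` (and `0` for the empty family). -/
noncomputable def maxProb {n : ℕ} (p : Fin n → unitInterval) : ℝ := ⨆ i, (p i : ℝ)

/-- The signed measure `L(W) - Π`, where `W = ∑ ξ_i` and `Π` is the Poisson distribution
with parameter `λ = ∑ p_i`. -/
noncomputable def poissonError {Ω : Type*} [MeasurableSpace Ω] (P : Measure Ω)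
    [IsProbabilityMeasure P] {n : ℕ} (p : Fin n → unitInterval) (ξ : Fin n → Ω → ℕ) :
    SignedMeasure ℕ :=
  (P.map fun ω => ∑ i, ξ i ω).toSignedMeasure
    - (poissonMeasure (Real.toNNReal (lam p))).toSignedMeasure

/-! Let `E` be the right shift on summable sequences and `z = E - 1`, inside the closed, commutative
algebra generated by `E`. Convolution becomes multiplication: the law of `W` is `∏ (1 + p i z)` and
the Poisson law is `exp (λ z)`. If a signed measure is `z * Q`, its partial sums are minus the
coefficients of `Q`, so its Wasserstein norm is the ℓ¹ norm of `Q`, and one factor `z` has to be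
cancelled.

Since `(1 + x) exp (-x) = 1 - x²/2 + O(x³)`, the law of `W` is `exp (λ z) ∏ (1 + c i z²)` with `c i
≈ -p i²/2`. Expanding the product gives `Q ≈ -(λ₂/2) z exp (λ z)`. The remainder is small because
`exp (λ z)` smooths: `‖z ^ n exp (λ z)‖ ≤ (n/λ) ^ (n/2)`, by applying a variance bound for `n = 1`
to each factor `exp ((λ/n) z)`. These powers of `λ` compensate the growth of the coefficients of the
product, which are controlled by `S ^ k / k!` with `S = ∑ ‖c i‖`.

The ℓ¹ norm of `z exp (λ z)` is exactly twice the Poisson weight at `⌊λ⌋`, a telescoping sum, and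
Stirling's formula evaluates that weight as `1/√(2πλ) + O(1/λ)`. The two errors give `max p` and
`1/√λ` respectively. The assembly is in `exists_prod_sub_exp_eq_mul_norm_le` and
`abs_wassersteinNorm_poissonError_sub_le`. -/

/-! ### Products of linear factors -/

/-- The coefficients of `∏ (1 + c i X)` are dominated by those of `exp ((∑ ‖c i‖) X)`. -/
theorem norm_coeff_prod_one_add_le {A ι : Type*} [NormedCommRing A] [NormOneClass A]
    (s : Finset ι) (c : ι → A) (k : ℕ) :
    ‖(∏ i ∈ s, (1 + Polynomial.C (c i) * Polynomial.X)).coeff k‖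
      ≤ (∑ i ∈ s, ‖c i‖) ^ k / k.factorial := by
  classical
  induction s using Finset.induction_on generalizing k with
  | empty =>
    cases k <;> simp [Polynomial.coeff_one]
  | insert a s ha ih =>
    rw [Finset.prod_insert ha, Finset.sum_insert ha, add_mul, one_mul, Polynomial.coeff_add]
    cases k with
    | zero => simpa [mul_assoc, Polynomial.mul_coeff_zero] using ih 0
    | succ k =>
      rw [mul_assoc, Polynomial.coeff_C_mul, mul_comm Polynomial.X, Polynomial.coeff_mul_X]
      set S := ∑ i ∈ s, ‖c i‖ with hS
      have hS0 : 0 ≤ S := Finset.sum_nonneg fun i _ => norm_nonneg _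
      -- These are the two top terms in `S` of the binomial expansion; the others are nonnegative.
      have hpow : S ^ (k + 1) + (k + 1) * (‖c a‖ * S ^ k) ≤ (‖c a‖ + S) ^ (k + 1) := by
        rw [add_comm ‖c a‖ S, add_pow, Finset.sum_range_succ, Finset.sum_range_succ]
        have : 0 ≤ ∑ x ∈ Finset.range k,
            S ^ x * ‖c a‖ ^ (k + 1 - x) * ((k + 1).choose x : ℝ) :=
          Finset.sum_nonneg fun i _ => by positivity
        simp
        linarith
      calc _ ≤ S ^ (k + 1) / (k + 1).factorial + ‖c a‖ * (S ^ k / k.factorial) :=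
            (norm_add_le _ _).trans (add_le_add (ih _)
              ((norm_mul_le _ _).trans (by gcongr; exact ih k)))
        _ = (S ^ (k + 1) + (k + 1) * (‖c a‖ * S ^ k)) / (k + 1).factorial := by
            rw [Nat.factorial_succ]; push_cast; field_simp
        _ ≤ _ := by gcongr

theorem coeff_zero_prod_one_add {A ι : Type*} [CommRing A] (s : Finset ι) (c : ι → A) :
    (∏ i ∈ s, (1 + Polynomial.C (c i) * Polynomial.X)).coeff 0 = 1 := by
  simp [Polynomial.coeff_zero_eq_eval_zero, Polynomial.eval_prod]

theorem coeff_one_prod_one_add {A ι : Type*} [CommRing A] (s : Finset ι) (c : ι → A) :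
    (∏ i ∈ s, (1 + Polynomial.C (c i) * Polynomial.X)).coeff 1 = ∑ i ∈ s, c i := by
  classical
  induction s using Finset.induction_on with
  | empty => simp [Polynomial.coeff_one]
  | insert a s ha ih =>
    rw [Finset.prod_insert ha, Finset.sum_insert ha, add_mul, one_mul, Polynomial.coeff_add, ih,
      mul_assoc, Polynomial.coeff_C_mul, mul_comm Polynomial.X, Polynomial.coeff_mul_X,
      coeff_zero_prod_one_add, mul_one, add_comm]

theorem natDegree_prod_one_add_le {A ι : Type*} [CommRing A] (s : Finset ι) (c : ι → A) :
    (∏ i ∈ s, (1 + Polynomial.C (c i) * Polynomial.X)).natDegree ≤ s.card := by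
  refine (Polynomial.natDegree_prod_le _ _).trans ?_
  rw [Finset.card_eq_sum_ones]
  refine Finset.sum_le_sum fun i _ => ?_
  compute_degree

/-- Expansion of `∏ (1 + c i y)` to first order, with the remainder in powers of `y`. -/
theorem prod_one_add_mul_eq {A ι : Type*} [CommRing A] (s : Finset ι) (c : ι → A) (y : A) :
    ∏ i ∈ s, (1 + c i * y) = 1 + (∑ i ∈ s, c i) * y +
      ∑ k ∈ Finset.range s.card,
        (∏ i ∈ s, (1 + Polynomial.C (c i) * Polynomial.X)).coeff (k + 2) * y ^ (k + 2) := by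
  have h : ∏ i ∈ s, (1 + c i * y)
      = (∏ i ∈ s, (1 + Polynomial.C (c i) * Polynomial.X)).eval y := by
    simp [Polynomial.eval_prod]
  rw [h, Polynomial.eval_eq_sum_range' (n := s.card + 2)
    (by have := natDegree_prod_one_add_le s c; omega), Finset.sum_range_succ',
    Finset.sum_range_succ', coeff_zero_prod_one_add, coeff_one_prod_one_add]
  ring

/-! ### Power series in a real Banach algebra -/

section BanachAlgebra

variable {A : Type*} [NormedCommRing A] [NormedAlgebra ℝ A] [CompleteSpace A]

theorem exp_add_smul (s t : ℝ) (x : A) :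
    NormedSpace.exp ((s + t) • x) = NormedSpace.exp (s • x) * NormedSpace.exp (t • x) := by
  let _ : NormedAlgebra ℚ A := NormedAlgebra.restrictScalars ℚ ℝ A
  rw [add_smul, NormedSpace.exp_add]

theorem exp_sum_smul {ι : Type*} (s : Finset ι) (p : ι → ℝ) (x : A) :
    NormedSpace.exp ((∑ i ∈ s, p i) • x) = ∏ i ∈ s, NormedSpace.exp (p i • x) := by
  classical
  induction s using Finset.induction_on with
  | empty => simp
  | insert a s ha ih => rw [Finset.sum_insert ha, Finset.prod_insert ha, exp_add_smul, ih]

theorem exp_nat_mul_smul (n : ℕ) (t : ℝ) (x : A) :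
    NormedSpace.exp ((n * t) • x) = NormedSpace.exp (t • x) ^ n := by
  simpa using exp_sum_smul (Finset.range n) (fun _ => t) x

theorem hasSum_exp_smul (t : ℝ) (x : A) :
    HasSum (fun n : ℕ => (t ^ n / n.factorial) • x ^ n) (NormedSpace.exp (t • x)) := by
  have h := NormedSpace.exp_series_hasSum_exp' (𝕂 := ℝ) (t • x)
  convert h using 2 with n
  rw [smul_pow, smul_smul]
  congr 1
  field_simp

variable [NormOneClass A]

theorem inv_factorial_add_three_le (k : ℕ) :
    ((k + 3).factorial : ℝ)⁻¹ ≤ (1 / 6) * (1 / 2) ^ k := by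
  have h : (6 : ℝ) * 2 ^ k ≤ (k + 3).factorial := by
    induction k with
    | zero => norm_num [Nat.factorial]
    | succ k ih =>
      rw [show k + 1 + 3 = (k + 3) + 1 by ring, Nat.factorial_succ]
      push_cast
      have : (0 : ℝ) ≤ k := k.cast_nonneg
      rw [pow_succ]
      nlinarith
  calc ((k + 3).factorial : ℝ)⁻¹ ≤ (6 * 2 ^ k)⁻¹ := inv_anti₀ (by positivity) h
    _ = _ := by simp [mul_comm]

/-- Third order Taylor expansion of the exponential. -/
theorem exists_exp_eq_taylor_three {y : A} (hy : ‖y‖ ≤ 1) :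
    ∃ v : A, NormedSpace.exp y = 1 + y + (1 / 2 : ℝ) • y ^ 2 + y ^ 3 * v ∧ ‖v‖ ≤ 1 / 3 := by
  have hb (k : ℕ) : ‖((k + 3).factorial : ℝ)⁻¹ • y ^ k‖ ≤ (1 / 6) * (1 / 2) ^ k := by
    rw [norm_smul, Real.norm_of_nonneg (by positivity)]
    calc _ ≤ ((k + 3).factorial : ℝ)⁻¹ * 1 := by
          gcongr
          exact (norm_pow_le y k).trans (pow_le_one₀ (norm_nonneg _) hy)
      _ ≤ _ := by simpa using inv_factorial_add_three_le k
  have hg : HasSum (fun k : ℕ => (1 / 6 : ℝ) * (1 / 2) ^ k) (1 / 3) := by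
    have := (hasSum_geometric_two).mul_left (1 / 6 : ℝ)
    norm_num at this ⊢
    exact this
  have hs : Summable fun k : ℕ => ((k + 3).factorial : ℝ)⁻¹ • y ^ k :=
    Summable.of_norm_bounded hg.summable hb
  refine ⟨∑' k : ℕ, ((k + 3).factorial : ℝ)⁻¹ • y ^ k, ?_, tsum_of_norm_bounded hg hb⟩
  have h := NormedSpace.exp_series_hasSum_exp' (𝕂 := ℝ) y
  rw [← h.tsum_eq, ← h.summable.sum_add_tsum_nat_add 3, ← hs.tsum_mul_left]
  congr 1
  · simp [Finset.sum_range_succ, Nat.factorial]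
  · congr 1
    ext k
    rw [mul_smul_comm, ← pow_add, add_comm 3 k]

/-- The first-order terms cancel, so replacing a Bernoulli factor by a Poisson one costs only `x²`.
Multiplying out the Taylor expansion of `exp (-x)` gives the cofactor `1/2 - v - x v` of `x³`. -/
theorem exists_one_add_mul_exp_neg {x : A} (hx : ‖x‖ ≤ 1 / 10) :
    ∃ w : A, (1 + x) * NormedSpace.exp (-x) = 1 - (1 / 2 : ℝ) • x ^ 2 + x ^ 3 * w ∧
      ‖w‖ ≤ 1 := by
  obtain ⟨v, hv, hv'⟩ := exists_exp_eq_taylor_three (y := -x) (by rw [norm_neg]; linarith)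
  refine ⟨(1 / 2 : ℝ) • 1 - v - x * v, ?_, ?_⟩
  · rw [hv]
    have h2 : (algebraMap ℝ A (1 / 2)) * 2 = 1 := by
      rw [← map_ofNat (algebraMap ℝ A) 2, ← map_mul]; norm_num
    simp only [Algebra.smul_def]
    linear_combination (x ^ 2) * h2
  · calc ‖(1 / 2 : ℝ) • (1 : A) - v - x * v‖ ≤ ‖(1 / 2 : ℝ) • (1 : A)‖ + ‖v‖ + ‖x‖ * ‖v‖ :=
          (norm_sub_le _ _).trans (add_le_add (norm_sub_le _ _) (norm_mul_le _ _))
      _ ≤ 1 / 2 + 1 / 3 + 1 / 10 * (1 / 3) := by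
          gcongr
          rw [norm_smul]; norm_num
      _ ≤ 1 := by norm_num

end BanachAlgebra

/-! ### Poisson weights -/

/-- The Poisson weight `e^{-t} t^k / k!`. -/
noncomputable def poissonWeight (t : ℝ) (k : ℕ) : ℝ := Real.exp (-t) * t ^ k / k.factorial

theorem poissonWeight_nonneg {t : ℝ} (ht : 0 ≤ t) (k : ℕ) : 0 ≤ poissonWeight t k := by
  unfold poissonWeight; positivity

theorem succ_mul_poissonWeight_succ (t : ℝ) (k : ℕ) :
    ((k + 1 : ℕ) : ℝ) * poissonWeight t (k + 1) = t * poissonWeight t k := by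
  unfold poissonWeight
  rw [Nat.factorial_succ]
  push_cast
  field_simp
  ring

theorem hasSum_poissonWeight (t : ℝ) : HasSum (poissonWeight t) 1 := by
  have h := (NormedSpace.expSeries_div_hasSum_exp t).mul_left (Real.exp (-t))
  rw [← Real.exp_eq_exp_ℝ, ← Real.exp_add, neg_add_cancel, Real.exp_zero] at h
  convert! h using 2 with k
  rw [poissonWeight, mul_div_assoc]

theorem hasSum_id_mul_poissonWeight (t : ℝ) :
    HasSum (fun k : ℕ => (k : ℝ) * poissonWeight t k) t := by
  rw [← hasSum_nat_add_iff' 1]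
  simp only [succ_mul_poissonWeight_succ]
  simpa using (hasSum_poissonWeight t).mul_left t

theorem hasSum_sq_mul_poissonWeight (t : ℝ) :
    HasSum (fun k : ℕ => (k : ℝ) ^ 2 * poissonWeight t k) (t ^ 2 + t) := by
  rw [← hasSum_nat_add_iff' 1]
  have h := ((hasSum_id_mul_poissonWeight t).add (hasSum_poissonWeight t)).mul_left t
  convert! h using 1
  · ext k
    rw [pow_two, mul_assoc, succ_mul_poissonWeight_succ]
    push_cast; ring
  · simp; ring

theorem hasSum_centered_sq_mul_poissonWeight {t : ℝ} (ht : 0 < t) :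
    HasSum (fun k : ℕ => (k / t - 1) ^ 2 * poissonWeight t k) (1 / t) := by
  have h := (((hasSum_sq_mul_poissonWeight t).mul_left (1 / t ^ 2)).sub
    ((hasSum_id_mul_poissonWeight t).mul_left (2 / t))).add (hasSum_poissonWeight t)
  convert! h using 1
  · ext k; field_simp; ring
  · field_simp; ring

theorem hasSum_centered_mul_poissonWeight {t : ℝ} (ht : 0 < t) :
    HasSum (fun k : ℕ => (k / t - 1) * poissonWeight t k) 0 := by
  have h := ((hasSum_id_mul_poissonWeight t).mul_left (1 / t)).sub (hasSum_poissonWeight t)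
  convert! h using 1
  · ext k; field_simp
  · field_simp; ring

/-! ### Smoothing by the Poisson semigroup -/

section Smoothing

variable {A : Type*} [NormedCommRing A] [NormedAlgebra ℝ A] [CompleteSpace A]

theorem hasSum_poissonWeight_smul_pow (t : ℝ) (E : A) :
    HasSum (fun k : ℕ => poissonWeight t k • E ^ k) (NormedSpace.exp (t • (E - 1))) := by
  have h1 : NormedSpace.exp ((-t) • (1 : A)) = Real.exp (-t) • (1 : A) := by
    refine (hasSum_exp_smul (-t) (1 : A)).unique ?_
    have := (NormedSpace.expSeries_div_hasSum_exp (-t)).smul_const (1 : A)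
    rw [← Real.exp_eq_exp_ℝ] at this
    simpa using this
  have h2 : NormedSpace.exp (t • (E - 1)) = Real.exp (-t) • NormedSpace.exp (t • E) := by
    let _ : NormedAlgebra ℚ A := NormedAlgebra.restrictScalars ℚ ℝ A
    rw [smul_sub, sub_eq_add_neg, ← neg_smul, NormedSpace.exp_add, h1, mul_smul_comm, mul_one]
  rw [h2]
  convert! (hasSum_exp_smul t E).const_smul (Real.exp (-t)) using 2 with k
  rw [smul_smul, poissonWeight, mul_div_assoc]

/-- Multiplication by `E` moves weight `k - 1` to position `k`, and that weight is `k / t` times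
weight `k`. -/
theorem hasSum_sub_one_mul_exp {t : ℝ} (ht : 0 < t) (E : A) :
    HasSum (fun k : ℕ => ((k / t - 1) * poissonWeight t k) • E ^ k)
      ((E - 1) * NormedSpace.exp (t • (E - 1))) := by
  have h0 := hasSum_poissonWeight_smul_pow t E
  have h1 : HasSum (fun k : ℕ => (k / t * poissonWeight t k) • E ^ k)
      (E * NormedSpace.exp (t • (E - 1))) := by
    rw [← hasSum_nat_add_iff' 1]
    convert! h0.mul_left E using 1
    · ext k
      rw [div_mul_eq_mul_div, succ_mul_poissonWeight_succ, mul_div_cancel_left₀ _ ht.ne',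
        mul_smul_comm, pow_succ']
    · simp
  rw [sub_mul, one_mul]
  convert! h1.sub h0 using 2 with k
  rw [sub_mul, one_mul, sub_smul]

variable [NormOneClass A]

/-- The norm is at most the mean of `|k/t - 1|` under the Poisson law, whose second moment is `1/t`.
Cauchy–Schwarz is used in the linearised form `|x| ≤ √t x²/2 + 1/(2√t)`, which can be summed
termwise. -/
theorem norm_sub_one_mul_exp_le {t : ℝ} (ht : 0 < t) {E : A} (hE : ‖E‖ ≤ 1) :
    ‖(E - 1) * NormedSpace.exp (t • (E - 1))‖ ≤ 1 / √t := by
  have hst : 0 < √t := Real.sqrt_pos.2 ht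
  have hb := ((hasSum_centered_sq_mul_poissonWeight ht).mul_left (√t / 2)).add
    ((hasSum_poissonWeight t).mul_left (1 / (2 * √t)))
  have hsum : √t / 2 * (1 / t) + 1 / (2 * √t) * 1 = 1 / √t := by
    have := Real.mul_self_sqrt ht.le
    field_simp
    nlinarith
  rw [hsum] at hb
  rw [← (hasSum_sub_one_mul_exp ht E).tsum_eq]
  refine tsum_of_norm_bounded hb fun k => ?_
  have hw := poissonWeight_nonneg ht.le k
  set x : ℝ := k / t - 1
  have hx : |x| ≤ √t / 2 * x ^ 2 + 1 / (2 * √t) := by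
    have h1 := sq_nonneg (√t * |x| - 1)
    have h2 : √t / 2 * x ^ 2 + 1 / (2 * √t) - |x| = (√t * |x| - 1) ^ 2 / (2 * √t) := by
      rw [← sq_abs x]; field_simp; ring
    have : 0 ≤ (√t * |x| - 1) ^ 2 / (2 * √t) := by positivity
    linarith
  calc ‖(x * poissonWeight t k) • E ^ k‖ ≤ |x| * poissonWeight t k * 1 := by
        rw [norm_smul, norm_mul, Real.norm_eq_abs, Real.norm_of_nonneg hw]
        gcongr
        exact (norm_pow_le E k).trans (pow_le_one₀ (norm_nonneg _) hE)
    _ ≤ (√t / 2 * x ^ 2 + 1 / (2 * √t)) * poissonWeight t k := by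
        rw [mul_one]; gcongr
    _ = _ := by ring

theorem norm_sub_one_pow_mul_exp_le {t : ℝ} (ht : 0 < t) {E : A} (hE : ‖E‖ ≤ 1) {n : ℕ}
    (hn : n ≠ 0) :
    ‖(E - 1) ^ n * NormedSpace.exp (t • (E - 1))‖ ≤ √(n / t) ^ n := by
  have hn' : (0 : ℝ) < n := by positivity
  have h : t = n * (t / n) := by field_simp
  conv_lhs => rw [h, exp_nat_mul_smul, ← mul_pow]
  refine (norm_pow_le _ n).trans (pow_le_pow_left₀ (norm_nonneg _) ?_ n)
  refine (norm_sub_one_mul_exp_le (div_pos ht hn') hE).trans_eq ?_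
  rw [one_div, ← Real.sqrt_inv, inv_div]

theorem norm_sub_one_sq_mul_exp_le {t : ℝ} (ht : 0 < t) {E : A} (hE : ‖E‖ ≤ 1) :
    ‖(E - 1) ^ 2 * NormedSpace.exp (t • (E - 1))‖ ≤ 2 / t := by
  refine (norm_sub_one_pow_mul_exp_le ht hE two_ne_zero).trans_eq ?_
  rw [Real.sq_sqrt (by positivity)]; norm_num

theorem norm_sub_one_odd_pow_mul_exp_le {t : ℝ} (ht : 0 < t) {E : A} (hE : ‖E‖ ≤ 1) {j : ℕ}
    (hj : j ≠ 0) :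
    ‖(E - 1) ^ (2 * j + 1) * NormedSpace.exp (t • (E - 1))‖ ≤ (4 * j / t) ^ j * (√2 / √t) := by
  -- Half of the time smooths the even power and half the single factor, which keeps a clean `1/√t`.
  have h : (E - 1) ^ (2 * j + 1) * NormedSpace.exp (t • (E - 1)) =
      ((E - 1) ^ (2 * j) * NormedSpace.exp ((t / 2) • (E - 1))) *
        ((E - 1) * NormedSpace.exp ((t / 2) • (E - 1))) := by
    conv_lhs => rw [← add_halves t, exp_add_smul]
    ring
  rw [h]
  refine (norm_mul_le _ _).trans (mul_le_mul
    ((norm_sub_one_pow_mul_exp_le (half_pos ht) hE (by omega)).trans_eq ?_)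
    ((norm_sub_one_mul_exp_le (half_pos ht) hE).trans_eq ?_) (norm_nonneg _) (by positivity))
  · rw [pow_mul, Real.sq_sqrt (by positivity)]
    congr 1
    push_cast; field_simp; norm_num
  · rw [Real.sqrt_div ht.le, one_div_div]

end Smoothing

/-! ### Comparison of the Bernoulli product with the Poisson exponential. -/

theorem nat_pow_le_three_pow_mul_factorial (j : ℕ) : (j : ℝ) ^ j ≤ 3 ^ j * j.factorial := by
  have h1 := Real.pow_div_factorial_le_exp (j : ℝ) j.cast_nonneg j
  have h2 : Real.exp j ≤ 3 ^ j := by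
    rw [← Real.exp_one_pow]
    exact pow_le_pow_left₀ (Real.exp_pos 1).le (by linarith [Real.exp_one_lt_d9]) j
  rw [div_le_iff₀ (by positivity)] at h1
  exact h1.trans (by gcongr)

theorem exists_prod_one_add_sub_one_eq_mul {A ι : Type*} [NormedCommRing A] [NormedAlgebra ℝ A]
    (s : Finset ι) (p : ι → ℝ) (x : A) :
    ∃ u : A, ∏ i ∈ s, (1 + p i • x) - 1 = x * u := by
  classical
  induction s using Finset.induction_on with
  | empty => exact ⟨0, by simp⟩
  | insert a s ha ih =>
    obtain ⟨u, hu⟩ := ih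
    refine ⟨u + p a • (1 + x * u), ?_⟩
    rw [Finset.prod_insert ha, ← sub_add_cancel (∏ i ∈ s, (1 + p i • x)) 1, hu]
    simp only [Algebra.smul_def]
    ring

section Approximation

variable {A : Type*} [NormedCommRing A] [NormedAlgebra ℝ A] [CompleteSpace A]

theorem exists_exp_sub_one_eq_mul (x : A) : ∃ u : A, NormedSpace.exp x - 1 = x * u := by
  have h := NormedSpace.exp_series_hasSum_exp' (𝕂 := ℝ) x
  have hu : Summable fun k : ℕ => ((k + 1).factorial : ℝ)⁻¹ • x ^ k := by
    refine Summable.of_norm_bounded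
      (NormedSpace.norm_expSeries_summable' (𝕂 := ℝ) x) fun k => ?_
    rw [norm_smul, norm_smul]
    gcongr
    rw [Real.norm_of_nonneg (by positivity), Real.norm_of_nonneg (by positivity)]
    gcongr
    omega
  refine ⟨∑' k : ℕ, ((k + 1).factorial : ℝ)⁻¹ • x ^ k, ?_⟩
  rw [← h.tsum_eq, ← h.summable.sum_add_tsum_nat_add 1, ← hu.tsum_mul_left]
  simp only [Finset.range_one, Finset.sum_singleton, Nat.factorial_zero, Nat.cast_one, inv_one,
    pow_zero, one_smul, add_sub_cancel_left, mul_smul_comm, pow_succ']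

/-- Both terms are `1` modulo `x`. No smallness is needed, so this yields finiteness of the norm for
every `n` in the limit statement. -/
theorem exists_prod_one_add_sub_exp_eq_mul {ι : Type*} (s : Finset ι) (p : ι → ℝ) (t : ℝ)
    (x : A) : ∃ Q : A, ∏ i ∈ s, (1 + p i • x) - NormedSpace.exp (t • x) = x * Q := by
  obtain ⟨u, hu⟩ := exists_prod_one_add_sub_one_eq_mul s p x
  obtain ⟨v, hv⟩ := exists_exp_sub_one_eq_mul (t • x)
  refine ⟨u - t • v, ?_⟩
  rw [← sub_sub_sub_cancel_right _ _ (1 : A), hu, hv, mul_sub, mul_smul_comm, smul_mul_assoc]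

variable [NormOneClass A]

/-- The remainder of order at least two in the expansion of a product, after smoothing. -/
theorem norm_sum_mul_odd_pow_mul_exp_le {lam S : ℝ} (hlam : 0 < lam) (hS : 0 ≤ S)
    (hSl : 12 * S / lam ≤ 9 / 25) {E : A} (hE : ‖E‖ ≤ 1) (d : ℕ → A)
    (hd : ∀ k, ‖d k‖ ≤ S ^ k / k.factorial) (n : ℕ) :
    ‖∑ k ∈ Finset.range n,
        d (k + 2) * ((E - 1) ^ (2 * (k + 1) + 1) * NormedSpace.exp (lam • (E - 1)))‖
      ≤ 19 * S ^ 2 / lam * (√2 / √lam) := by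
  have hr0 : 0 ≤ 12 * S / lam := by positivity
  set r := 12 * S / lam with hr
  have hterm (k : ℕ) : ‖d (k + 2) *
      ((E - 1) ^ (2 * (k + 1) + 1) * NormedSpace.exp (lam • (E - 1)))‖
      ≤ S * r * (√2 / √lam) * r ^ k := by
    calc _ ≤ S ^ (k + 2) / (k + 2).factorial *
          ((4 * (k + 1 : ℕ) / lam) ^ (k + 1) * (√2 / √lam)) :=
          (norm_mul_le _ _).trans (mul_le_mul (hd _)
            (norm_sub_one_odd_pow_mul_exp_le hlam hE k.succ_ne_zero) (norm_nonneg _)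
            (by positivity))
      -- The factorial from the product coefficients absorbs `(k+1)^(k+1)` up to `3^(k+1)`, leaving
      -- a geometric series of ratio `r = 12 S / lam`.
      _ ≤ S ^ (k + 2) / (k + 1).factorial *
          ((4 / lam) ^ (k + 1) * (3 ^ (k + 1) * (k + 1).factorial) * (√2 / √lam)) := by
          rw [show (4 * ((k + 1 : ℕ) : ℝ) / lam) ^ (k + 1)
            = (4 / lam) ^ (k + 1) * ((k + 1 : ℕ) : ℝ) ^ (k + 1) by rw [← mul_pow]; ring]
          gcongr
          · omega
          · exact nat_pow_le_three_pow_mul_factorial _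
      _ = S * r ^ (k + 1) * (√2 / √lam) := by
          have h : r ^ (k + 1) = S ^ (k + 1) * (4 / lam) ^ (k + 1) * 3 ^ (k + 1) := by
            rw [← mul_pow, ← mul_pow, hr]; ring
          rw [h, pow_succ' S (k + 1)]
          field_simp
      _ = _ := by ring
  have hgeom : ∑ k ∈ Finset.range n, r ^ k ≤ 25 / 16 := by
    refine ((summable_geometric_of_lt_one hr0 (by linarith)).sum_le_tsum _
      fun k _ => pow_nonneg hr0 k).trans ?_
    rw [tsum_geometric_of_lt_one hr0 (by linarith)]
    calc (1 - r)⁻¹ ≤ (16 / 25)⁻¹ := inv_anti₀ (by norm_num) (by linarith)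
      _ = 25 / 16 := by norm_num
  calc _ ≤ ∑ k ∈ Finset.range n, S * r * (√2 / √lam) * r ^ k :=
        (norm_sum_le _ _).trans (Finset.sum_le_sum fun k _ => hterm k)
    _ = S * r * (√2 / √lam) * ∑ k ∈ Finset.range n, r ^ k := by rw [Finset.mul_sum]
    _ ≤ S * r * (√2 / √lam) * (19 / 12) := by gcongr; linarith
    _ = _ := by rw [hr]; ring

/-- Poisson approximation of a product of Bernoulli factors, with the leading error term. -/
theorem exists_prod_sub_exp_eq_mul_norm_le {ι : Type*} (s : Finset ι) (p : ι → ℝ) {m : ℝ}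
    (hp0 : ∀ i ∈ s, 0 ≤ p i) (hpm : ∀ i ∈ s, p i ≤ m) (hm : m ≤ 1 / 20)
    (hlam : 1 ≤ ∑ i ∈ s, p i) {E : A} (hE : ‖E‖ ≤ 1) :
    ∃ Q : A, ∏ i ∈ s, (1 + p i • (E - 1)) - NormedSpace.exp ((∑ i ∈ s, p i) • (E - 1))
        = (E - 1) * Q ∧
      ‖Q + ((∑ i ∈ s, p i ^ 2) / 2) •
          ((E - 1) * NormedSpace.exp ((∑ i ∈ s, p i) • (E - 1)))‖
        ≤ 13 * (∑ i ∈ s, p i ^ 2) / √(∑ i ∈ s, p i) * m := by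
  set lam := ∑ i ∈ s, p i with hlamdef
  set lam2 := ∑ i ∈ s, p i ^ 2 with hlam2def
  set z := E - 1 with hz
  have hlam0 : 0 < lam := by linarith
  have hsl : 0 < √lam := Real.sqrt_pos.2 hlam0
  have hlam2 : 0 ≤ lam2 := Finset.sum_nonneg fun i _ => sq_nonneg _
  have hlam2m : lam2 ≤ m * lam := by
    rw [hlam2def, hlamdef, Finset.mul_sum]
    refine Finset.sum_le_sum fun i hi => ?_
    rw [pow_two]
    exact mul_le_mul_of_nonneg_right (hpm i hi) (hp0 i hi)
  have hm0 : 0 ≤ m := by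
    by_contra h
    nlinarith
  have hzn : ‖z‖ ≤ 2 := (norm_sub_le _ _).trans (by rw [norm_one]; linarith)
  have hpz (i) (hi : i ∈ s) : ‖p i • z‖ ≤ 2 * p i := by
    rw [norm_smul, Real.norm_of_nonneg (hp0 i hi)]
    nlinarith [hp0 i hi]
  have hex (i : ι) : ∃ w : A, i ∈ s → (1 + p i • z) * NormedSpace.exp (-(p i • z))
      = 1 - (1 / 2 : ℝ) • (p i • z) ^ 2 + (p i • z) ^ 3 * w ∧ ‖w‖ ≤ 1 := by
    by_cases hi : i ∈ s
    · obtain ⟨w, hw⟩ := exists_one_add_mul_exp_neg (x := p i • z)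
        ((hpz i hi).trans (by linarith [hpm i hi]))
      exact ⟨w, fun _ => hw⟩
    · exact ⟨0, fun h => absurd h hi⟩
  choose w hw using hex
  -- Chosen so that `(1 + p i z) exp (-p i z) = 1 + c i z²`; the norm bound `3/5` below is `1/2 +
  -- 2/20`.
  set c : ι → A := fun i => p i ^ 2 • (-(1 / 2 : ℝ) • (1 : A) + p i • (z * w i)) with hc
  have hcn (i) (hi : i ∈ s) : ‖c i‖ ≤ 3 / 5 * p i ^ 2 := by
    have h1 : ‖z * w i‖ ≤ 2 :=
      (norm_mul_le _ _).trans (by nlinarith [(hw i hi).2, norm_nonneg z, norm_nonneg (w i)])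
    have h2 : ‖-(1 / 2 : ℝ) • (1 : A) + p i • (z * w i)‖ ≤ 3 / 5 := by
      refine (norm_add_le _ _).trans ?_
      rw [norm_smul, norm_smul, norm_one, Real.norm_of_nonneg (hp0 i hi)]
      norm_num
      nlinarith [hp0 i hi, hpm i hi]
    rw [hc, norm_smul, Real.norm_of_nonneg (sq_nonneg _)]
    nlinarith [sq_nonneg (p i)]
  have hfac : ∏ i ∈ s, (1 + p i • z) = NormedSpace.exp (lam • z) * ∏ i ∈ s, (1 + c i * z ^ 2) := by
    rw [hlamdef, exp_sum_smul, ← Finset.prod_mul_distrib]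
    refine Finset.prod_congr rfl fun i hi => ?_
    have h1 : 1 + c i * z ^ 2 = (1 + p i • z) * NormedSpace.exp (-(p i • z)) := by
      rw [(hw i hi).1, hc]
      simp only [Algebra.smul_def, map_pow, map_neg]
      ring
    have h2 : NormedSpace.exp (p i • z) * NormedSpace.exp (-(p i • z)) = 1 := by
      rw [← neg_smul, ← exp_add_smul, add_neg_cancel, zero_smul, NormedSpace.exp_zero]
    rw [h1, mul_left_comm, h2, mul_one]
  set d : ℕ → A := fun k => (∏ i ∈ s, (1 + Polynomial.C (c i) * Polynomial.X)).coeff k with hd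
  set S := ∑ i ∈ s, ‖c i‖ with hS
  have hS0 : 0 ≤ S := Finset.sum_nonneg fun i _ => norm_nonneg _
  have hS2 : S ≤ 3 / 5 * lam2 := by
    rw [hS, hlam2def, Finset.mul_sum]
    exact Finset.sum_le_sum hcn
  set e := NormedSpace.exp (lam • z) with he
  set R := ∑ k ∈ Finset.range s.card, d (k + 2) * (z ^ (2 * (k + 1) + 1) * e) with hR
  have hsum : ∑ i ∈ s, c i = -((lam2 / 2) • (1 : A)) + (∑ i ∈ s, p i ^ 3 • w i) * z := by
    rw [hlam2def, Finset.sum_div, Finset.sum_smul, ← Finset.sum_neg_distrib, Finset.sum_mul,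
      ← Finset.sum_add_distrib]
    refine Finset.sum_congr rfl fun i _ => ?_
    simp only [hc]
    rw [smul_add, smul_smul, smul_smul, ← neg_smul, smul_mul_assoc, mul_comm z]
    congr 2
    ring
  -- The expansion of `e * ∏ (1 + c i z²) - e` with one factor `z` removed from each term.
  refine ⟨(∑ i ∈ s, c i) * (z * e) + R, ?_, ?_⟩
  · rw [hfac, prod_one_add_mul_eq, hR, mul_add z, Finset.mul_sum, mul_add e, Finset.mul_sum,
      add_sub_right_comm]
    congr 1
    · ring
    · refine Finset.sum_congr rfl fun k _ => ?_
      rw [← pow_mul]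
      ring
  · have h1 : (∑ i ∈ s, c i) * (z * e) + R + (lam2 / 2) • (z * e)
        = (∑ i ∈ s, p i ^ 3 • w i) * (z ^ 2 * e) + R := by
      rw [hsum, ← smul_one_mul (lam2 / 2) (z * e)]
      ring
    have h2 : ‖∑ i ∈ s, p i ^ 3 • w i‖ ≤ m * lam2 := by
      rw [hlam2def, Finset.mul_sum]
      refine norm_sum_le_of_le _ fun i hi => ?_
      have := hp0 i hi
      rw [norm_smul, Real.norm_of_nonneg (by positivity)]
      calc p i ^ 3 * ‖w i‖ ≤ p i ^ 3 * 1 := by gcongr; exact (hw i hi).2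
        _ = p i * p i ^ 2 := by ring
        _ ≤ m * p i ^ 2 := by gcongr; exact hpm i hi
    have hSl : S / lam ≤ 3 / 5 * m := by
      rw [div_le_iff₀ hlam0]; linarith
    -- Here `12 S / lam ≤ 12 * (3/5) * (1/20) = 9/25`.
    have h3 := norm_sum_mul_odd_pow_mul_exp_le hlam0 hS0 (by
      rw [mul_div_assoc]; linarith) hE d (norm_coeff_prod_one_add_le s c) s.card
    have h4 := norm_sub_one_sq_mul_exp_le hlam0 hE
    rw [← hz, ← he] at h3 h4
    have hs2 : √2 ≤ 3 / 2 := by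
      rw [Real.sqrt_le_left (by norm_num)]; norm_num
    have hsl1 : √lam ≤ lam := by
      rw [Real.sqrt_le_left hlam0.le]; nlinarith
    rw [h1]
    calc _ ≤ ‖∑ i ∈ s, p i ^ 3 • w i‖ * ‖z ^ 2 * e‖ + ‖R‖ :=
          (norm_add_le _ _).trans (by gcongr; exact norm_mul_le _ _)
      _ ≤ m * lam2 * (2 / lam) + 19 * S ^ 2 / lam * (√2 / √lam) := by
          gcongr
      _ = m * lam2 * (2 / lam) + 19 * S * (S / lam) * (√2 / √lam) := by ring
      _ ≤ m * lam2 * (2 / √lam) + 19 * (3 / 5 * lam2) * (3 / 5 * m) * ((3 / 2) / √lam) := by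
          gcongr
      _ = (2 + 1026 / 100) * lam2 / √lam * m := by ring
      _ ≤ 13 * lam2 / √lam * m := by gcongr; norm_num

end Approximation

/-! ### The mode of the Poisson distribution -/

/-- The sum telescopes: each summand is the difference of weights `k` and `k - 1`. -/
theorem sum_range_one_sub_mul_poissonWeight {t : ℝ} (ht : 0 < t) (n : ℕ) :
    ∑ k ∈ Finset.range (n + 1), (1 - k / t) * poissonWeight t k = poissonWeight t n := by
  induction n with
  | zero => simp
  | succ n ih =>
    rw [Finset.sum_range_succ, ih, sub_mul, div_mul_eq_mul_div, succ_mul_poissonWeight_succ]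
    field_simp
    ring

/-- The centred sequence sums to zero and changes sign just after `⌊t⌋`, so its absolute sum is
twice its negative part. -/
theorem hasSum_abs_centered_mul_poissonWeight {t : ℝ} (ht : 0 < t) :
    HasSum (fun k : ℕ => |(k / t - 1) * poissonWeight t k|) (2 * poissonWeight t ⌊t⌋₊) := by
  have h1 := hasSum_centered_mul_poissonWeight ht
  have h2 : HasSum (fun k : ℕ => if k ∈ Finset.range (⌊t⌋₊ + 1)
      then (1 - k / t) * poissonWeight t k else 0) (poissonWeight t ⌊t⌋₊) := by
    rw [← sum_range_one_sub_mul_poissonWeight ht ⌊t⌋₊,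
      ← Finset.sum_congr rfl fun k hk => if_pos (c := k ∈ Finset.range (⌊t⌋₊ + 1)) hk]
    exact hasSum_sum_of_ne_finset_zero (s := Finset.range (⌊t⌋₊ + 1)) fun k hk => if_neg hk
  have h3 := h1.add (h2.mul_left 2)
  rw [zero_add] at h3
  convert! h3 using 2 with k
  have hw := poissonWeight_nonneg ht.le k
  split_ifs with hk
  · have hkt : (k : ℝ) / t ≤ 1 := by
      rw [div_le_one ht]
      exact (Nat.le_floor_iff ht.le).1 (Nat.lt_succ_iff.1 (Finset.mem_range.1 hk))
    rw [abs_of_nonpos (mul_nonpos_of_nonpos_of_nonneg (by linarith) hw)]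
    ring
  · have hkt : 1 ≤ (k : ℝ) / t := by
      rw [one_le_div ht]
      exact (Nat.lt_of_floor_lt (by simpa using hk)).le
    rw [abs_of_nonneg (mul_nonneg (by linarith) hw)]
    ring

theorem log_stirlingSeq_le {n : ℕ} (hn : n ≠ 0) :
    Real.log (Stirling.stirlingSeq n) ≤ Real.log √Real.pi + 1 / (12 * n) := by
  obtain ⟨n, rfl⟩ := Nat.exists_eq_succ_of_ne_zero hn
  set f : ℕ → ℝ := fun k => Real.log (Stirling.stirlingSeq (k + 1)) - 1 / (12 * ((k + 1 : ℕ) : ℝ))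
    with hf
  have hmono : Monotone f := monotone_nat_of_le_succ fun k => by
    have h := Stirling.log_stirlingSeq_sdiff_le (k + 1)
    -- The bound on successive differences telescopes, so `f` increases to its limit `log √π`.
    have h2 : (1 : ℝ) / (12 * (k + 1 : ℕ) * ((k + 1 : ℕ) + 1))
        = 1 / (12 * ((k + 1 : ℕ) : ℝ)) - 1 / (12 * ((k + 1 + 1 : ℕ) : ℝ)) := by
      push_cast; field_simp; ring
    simp only [hf]
    linarith
  have hlim : Tendsto f atTop (𝓝 (Real.log √Real.pi - 0)) := by
    refine Tendsto.sub ?_ ?_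
    · exact ((Real.continuousAt_log (by positivity)).tendsto.comp
        Stirling.tendsto_stirlingSeq_sqrt_pi).comp (tendsto_add_atTop_nat 1)
    · have h := (tendsto_one_div_add_atTop_nhds_zero_nat (𝕜 := ℝ)).const_mul (1 / 12)
      rw [mul_zero] at h
      refine h.congr fun k => ?_
      push_cast; field_simp
  have := hmono.ge_of_tendsto hlim n
  simp only [hf] at this
  simp only [Nat.succ_eq_add_one]
  linarith

theorem log_sqrt_mul_poissonWeight {t : ℝ} (ht : 0 < t) {m : ℕ} (hm : m ≠ 0) :
    Real.log (√(2 * Real.pi * t) * poissonWeight t m) =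
      Real.log (t / m) / 2 + (m * Real.log (t / m) - (t - m))
        - (Real.log (Stirling.stirlingSeq m) - Real.log √Real.pi) := by
  have hm' : (0 : ℝ) < m := by positivity
  rw [Stirling.log_stirlingSeq_formula, poissonWeight, Real.log_mul (by positivity) (by positivity),
    Real.log_div (by positivity) (by positivity), Real.log_mul (by positivity) (by positivity),
    Real.log_exp, Real.log_pow, Real.log_sqrt (by positivity), Real.log_sqrt (by positivity),
    Real.log_mul (by positivity) (by positivity), Real.log_mul (by positivity) (by positivity),
    Real.log_div ht.ne' hm'.ne', Real.log_mul (by positivity) hm'.ne',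
    Real.log_div hm'.ne' (by positivity), Real.log_exp]
  ring

/-- The maximal Poisson weight is `1 / √(2πt)` up to an error of smaller order. -/
theorem abs_poissonWeight_floor_sub_le {t : ℝ} (ht : 1 ≤ t) :
    |poissonWeight t ⌊t⌋₊ - 1 / √(2 * Real.pi * t)| ≤ 4 / t := by
  have ht0 : 0 < t := by linarith
  set m := ⌊t⌋₊ with hm
  have hm1 : 1 ≤ m := Nat.le_floor (by simpa using ht)
  have hm0 : m ≠ 0 := by omega
  have hm' : (1 : ℝ) ≤ m := by exact_mod_cast hm1
  have hmt : (m : ℝ) ≤ t := Nat.floor_le ht0.le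
  have htm : t < m + 1 := Nat.lt_floor_add_one t
  have hmpos : (0 : ℝ) < m := by linarith
  set x := t / m - 1 with hx
  have hx0 : 0 ≤ x := by rw [hx, sub_nonneg, one_le_div hmpos]; exact hmt
  have hmx : m * x = t - m := by rw [hx]; field_simp
  have hx1 : x ≤ 1 / m := by rw [le_div_iff₀ hmpos]; linarith
  have hlog1 : Real.log (t / m) ≤ x := by
    have := Real.log_le_sub_one_of_pos (div_pos ht0 hmpos); exact this
  have hlog0 : 0 ≤ Real.log (t / m) := Real.log_nonneg (by linarith)
  have hlog2 : x - x ^ 2 / 2 ≤ Real.log (t / m) := by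
    have h := Real.le_log_one_add_of_nonneg hx0
    rw [show 1 + x = t / m by rw [hx]; ring] at h
    refine le_trans ?_ h
    rw [le_div_iff₀ (by linarith)]
    nlinarith [pow_nonneg hx0 3]
  have hs1 := log_stirlingSeq_le hm0
  have hs0 : Real.log √Real.pi ≤ Real.log (Stirling.stirlingSeq m) :=
    Real.log_le_log (by positivity) (Stirling.sqrt_pi_le_stirlingSeq hm0)
  have hwpos : 0 < √(2 * Real.pi * t) * poissonWeight t m := by
    unfold poissonWeight; positivity
  have ha := log_sqrt_mul_poissonWeight ht0 hm0
  set a := Real.log (√(2 * Real.pi * t) * poissonWeight t m) with hadef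
  have h12 : (1 : ℝ) / (12 * m) = 1 / 12 * (1 / m) := by field_simp
  rw [h12] at hs1
  have hinv : (0 : ℝ) < 1 / m := by positivity
  have hb1 : m * Real.log (t / m) ≤ t - m := by
    rw [← hmx]; gcongr
  have hb2 : t - m - 1 / 2 * (1 / m) ≤ m * Real.log (t / m) := by
    have h1 : (m : ℝ) * (x - x ^ 2 / 2) ≤ m * Real.log (t / m) := by gcongr
    have h2 : (m : ℝ) * x ^ 2 ≤ 1 / m := by
      have : (m : ℝ) * x ≤ 1 := by linarith
      nlinarith
    nlinarith
  -- The three terms of `ha` lie in `[0, 1/(2m)]`, `[-1/(2m), 0]` and `[-1/(12m), 0]`.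
  have haabs : |a| ≤ 1 / m := by
    rw [abs_le]; constructor <;> linarith
  have h2t : (1 : ℝ) / m ≤ 2 / t := by
    rw [div_le_div_iff₀ hmpos ht0]; linarith
  have hexp := Real.abs_exp_sub_one_le (x := a)
    (haabs.trans ((div_le_one hmpos).2 hm'))
  rw [hadef, Real.exp_log hwpos, ← hadef] at hexp
  have hsq : 1 ≤ √(2 * Real.pi * t) := by
    rw [Real.one_le_sqrt]; nlinarith [Real.pi_gt_three]
  have hsq0 : 0 < √(2 * Real.pi * t) := by linarith
  have hfin : |poissonWeight t m - 1 / √(2 * Real.pi * t)|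
      = |√(2 * Real.pi * t) * poissonWeight t m - 1| / √(2 * Real.pi * t) := by
    rw [eq_div_iff hsq0.ne', ← abs_of_pos hsq0, ← abs_mul, abs_of_pos hsq0]
    congr 1
    field_simp
  rw [hfin]
  refine (div_le_self (abs_nonneg _) hsq).trans (hexp.trans ?_)
  calc 2 * |a| ≤ 2 * (2 / t) := by linarith
    _ = 4 / t := by ring

/-! ### The convolution algebra of summable sequences -/

/-- The Banach space of summable real sequences. -/
abbrev SummableSeq := lp (fun _ : ℕ => ℝ) 1

theorem summable_abs_summableSeq (f : SummableSeq) : Summable fun k => |f k| := by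
  simpa using (lp.memℓp f).summable (by simp)

theorem norm_summableSeq (f : SummableSeq) : ‖f‖ = ∑' k, |f k| := by
  simpa using lp.norm_eq_tsum_rpow (p := 1) (by simp) f

/-- The sequence `0, f 0, f 1, …`. -/
def shiftFun (f : ℕ → ℝ) : ℕ → ℝ
  | 0 => 0
  | k + 1 => f k

theorem memℓp_shiftFun (f : SummableSeq) : Memℓp (shiftFun f) 1 := by
  refine memℓp_gen ?_
  rw [← summable_nat_add_iff 1]
  simpa [shiftFun] using summable_abs_summableSeq f

/-- The right shift on summable sequences. -/
noncomputable def rightShift : SummableSeq →L[ℝ] SummableSeq :=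
  LinearMap.mkContinuous
    { toFun := fun f => ⟨shiftFun f, memℓp_shiftFun f⟩
      map_add' := fun f g => by
        ext k
        cases k with
        | zero => exact (add_zero (0 : ℝ)).symm
        | succ k => rfl
      map_smul' := fun c f => by
        ext k
        cases k <;> simp [shiftFun] }
    1 fun f => by
      have hs := summable_abs_summableSeq ⟨shiftFun f, memℓp_shiftFun f⟩
      rw [one_mul, norm_summableSeq, norm_summableSeq f]
      refine le_of_eq ?_
      change ∑' k, |shiftFun f k| = _
      rw [← (show Summable fun k => |shiftFun f k| from hs).sum_add_tsum_nat_add 1]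
      simp [shiftFun]

theorem norm_rightShift_le : ‖rightShift‖ ≤ 1 :=
  LinearMap.mkContinuous_norm_le _ zero_le_one _

/-- The closed algebra generated by the right shift, a model of the convolution algebra. -/
def ConvAlgebra : Type := Algebra.elemental ℝ rightShift

noncomputable instance : NormedCommRing ConvAlgebra :=
  { SubringClass.toNormedRing (Algebra.elemental ℝ rightShift) with
    mul_comm := mul_comm (G := Algebra.elemental ℝ rightShift) }

noncomputable instance : NormedAlgebra ℝ ConvAlgebra :=
  inferInstanceAs (NormedAlgebra ℝ (Algebra.elemental ℝ rightShift))

instance : CompleteSpace ConvAlgebra :=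
  inferInstanceAs (CompleteSpace (Algebra.elemental ℝ rightShift))

/-- The unit sequence at `0`. -/
noncomputable def unitSeq : SummableSeq := lp.single 1 0 1

theorem unitSeq_apply (k : ℕ) : unitSeq k = if k = 0 then 1 else 0 := by
  simp [unitSeq, Pi.single_apply]

theorem norm_unitSeq : ‖unitSeq‖ = 1 := by
  rw [unitSeq, lp.norm_single one_pos, norm_one]

instance : NormOneClass ConvAlgebra where
  norm_one := by
    have : Nontrivial SummableSeq := ⟨⟨unitSeq, 0, fun h => by
      have := norm_unitSeq; rw [h, norm_zero] at this; exact zero_ne_one this⟩⟩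
    change ‖(1 : SummableSeq →L[ℝ] SummableSeq)‖ = 1
    exact norm_one

/-- The right shift as an element of the convolution algebra. -/
noncomputable def shiftElem : ConvAlgebra := ⟨rightShift, Algebra.elemental.self_mem ℝ _⟩

theorem norm_shiftElem_le : ‖shiftElem‖ ≤ 1 := norm_rightShift_le

/-- The coefficient sequence of an element of the convolution algebra. -/
noncomputable def coeffs : ConvAlgebra →L[ℝ] SummableSeq :=
  LinearMap.mkContinuous
    { toFun := fun a => a.1 unitSeq
      map_add' := fun _ _ => rfl
      map_smul' := fun _ _ => rfl }
    1 fun a => by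
      refine (ContinuousLinearMap.le_opNorm a.1 _).trans_eq ?_
      rw [norm_unitSeq, mul_one, one_mul]
      rfl

/-- Evaluation at a unit vector is a contraction; this turns operator norm estimates of remainders
into ℓ¹ estimates. -/
theorem norm_coeffs_le (a : ConvAlgebra) : ‖coeffs a‖ ≤ ‖a‖ := by
  refine (coeffs.le_of_opNorm_le (LinearMap.mkContinuous_norm_le _ zero_le_one _) a).trans_eq ?_
  rw [one_mul]

theorem coeffs_sub (a b : ConvAlgebra) (k : ℕ) :
    coeffs (a - b) k = coeffs a k - coeffs b k := by
  have h : coeffs (a - b) = coeffs a - coeffs b := map_sub coeffs a b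
  rw [h]
  rfl

theorem coeffs_one (k : ℕ) : coeffs 1 k = if k = 0 then 1 else 0 := unitSeq_apply k

theorem coeffs_shiftElem_mul_zero (a : ConvAlgebra) : coeffs (shiftElem * a) 0 = 0 := rfl

theorem coeffs_shiftElem_mul_succ (a : ConvAlgebra) (k : ℕ) :
    coeffs (shiftElem * a) (k + 1) = coeffs a k := rfl

theorem coeffs_shiftElem_pow (n k : ℕ) : coeffs (shiftElem ^ n) k = if k = n then 1 else 0 := by
  induction n generalizing k with
  | zero => rw [pow_zero, coeffs_one]
  | succ n ih =>
    rw [pow_succ']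
    cases k with
    | zero => simp [coeffs_shiftElem_mul_zero]
    | succ k => simp [coeffs_shiftElem_mul_succ, ih]

theorem coeffs_eq_of_hasSum {c : ℕ → ℝ} {a : ConvAlgebra}
    (h : HasSum (fun k => c k • shiftElem ^ k) a) (j : ℕ) : coeffs a j = c j := by
  have h1 := (h.mapL coeffs).mapL (lp.evalCLM ℝ (fun _ : ℕ => ℝ) 1 j)
  refine h1.unique ?_
  convert! hasSum_ite_eq j (c j) using 2 with k
  change coeffs (c k • shiftElem ^ k) j = _
  rw [coeffs.map_smul, lp.coeFn_smul, Pi.smul_apply, coeffs_shiftElem_pow]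
  by_cases hk : k = j
  · simp [hk]
  · simp [hk, Ne.symm hk]

theorem coeffs_exp (t : ℝ) (k : ℕ) :
    coeffs (NormedSpace.exp (t • (shiftElem - 1))) k = poissonWeight t k :=
  coeffs_eq_of_hasSum (hasSum_poissonWeight_smul_pow t shiftElem) k

theorem norm_coeffs_sub_one_mul_exp {t : ℝ} (ht : 0 < t) :
    ‖coeffs ((shiftElem - 1) * NormedSpace.exp (t • (shiftElem - 1)))‖
      = 2 * poissonWeight t ⌊t⌋₊ := by
  rw [norm_summableSeq, ← (hasSum_abs_centered_mul_poissonWeight ht).tsum_eq]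
  simp_rw [coeffs_eq_of_hasSum (hasSum_sub_one_mul_exp ht shiftElem)]

/-- Division by `E - 1` amounts to summation. -/
theorem sum_coeffs_sub_one_mul (a : ConvAlgebra) (j : ℕ) :
    ∑ k ∈ Finset.range (j + 1), coeffs ((shiftElem - 1) * a) k = -coeffs a j := by
  have h (k : ℕ) : coeffs ((shiftElem - 1) * a) k = coeffs (shiftElem * a) k - coeffs a k := by
    rw [sub_mul, one_mul, coeffs_sub]
  induction j with
  | zero => simp [h, coeffs_shiftElem_mul_zero]
  | succ j ih =>
    rw [Finset.sum_range_succ, ih, h, coeffs_shiftElem_mul_succ]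
    ring

theorem coeffs_one_add_smul_mul (r : ℝ) (a : ConvAlgebra) (k : ℕ) :
    coeffs ((1 + r • (shiftElem - 1)) * a) k
      = (1 - r) * coeffs a k + r * coeffs (shiftElem * a) k := by
  have h : (1 + r • (shiftElem - 1)) * a = (1 - r) • a + r • (shiftElem * a) := by
    rw [add_mul, one_mul, smul_mul_assoc, sub_mul, one_mul, smul_sub, sub_smul, one_smul]
    abel
  rw [h, coeffs.map_add, coeffs.map_smul, coeffs.map_smul]
  rfl

/-! ### The law of a Bernoulli sum -/

section Law

variable {Ω : Type*} [MeasurableSpace Ω] {P : Measure Ω}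
  {n : ℕ} {p : Fin n → unitInterval} {ξ : Fin n → Ω → ℕ}

theorem IsIndepBernoulli.ae_le_one (h : IsIndepBernoulli P p ξ) (i : Fin n) :
    ∀ᵐ ω ∂P, ξ i ω = 0 ∨ ξ i ω = 1 := by
  classical
  have h2 : P {ω | ¬ (ξ i ω = 0 ∨ ξ i ω = 1)} = 0 := by
    rw [(h.law i).measure_eq (p := fun k : ℕ => ¬ (k = 0 ∨ k = 1)) .of_discrete,
      bernoulliMeasure_apply _ .of_discrete]
    simp
  exact h2

theorem IsIndepBernoulli.real_eq_one (h : IsIndepBernoulli P p ξ) (i : Fin n) :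
    P.real {ω | ξ i ω = 1} = p i := by
  classical
  rw [measureReal_def, (h.law i).measure_eq (p := fun k : ℕ => k = 1) .of_discrete,
    bernoulliMeasure_apply _ .of_discrete]
  simp

theorem IsIndepBernoulli.real_eq_zero (h : IsIndepBernoulli P p ξ) (i : Fin n) :
    P.real {ω | ξ i ω = 0} = 1 - p i := by
  classical
  rw [measureReal_def, (h.law i).measure_eq (p := fun k : ℕ => k = 0) .of_discrete,
    bernoulliMeasure_apply _ .of_discrete]
  simp

variable [IsProbabilityMeasure P]

/-- Adding an independent Bernoulli variable convolves the law with `(1 - r) + r E = 1 + r (E - 1)`.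
-/
theorem IsIndepBernoulli.real_sum_eq (h : IsIndepBernoulli P p ξ) (s : Finset (Fin n)) (k : ℕ) :
    P.real {ω | ∑ i ∈ s, ξ i ω = k}
      = coeffs (∏ i ∈ s, (1 + (p i : ℝ) • (shiftElem - 1))) k := by
  classical
  induction s using Finset.induction_on generalizing k with
  | empty =>
    rw [Finset.prod_empty, coeffs_one]
    by_cases hk : k = 0
    · simp [hk]
    · simp [hk, Ne.symm hk]
  | insert a s ha ih =>
    have hind := h.indep.indepFun_finsetSum_of_notMem₀ (fun i => (h.law i).aemeasurable) ha
    have hmul (j l : ℕ) : P.real {ω | ∑ i ∈ s, ξ i ω = j ∧ ξ a ω = l}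
        = P.real {ω | ∑ i ∈ s, ξ i ω = j} * P.real {ω | ξ a ω = l} := by
      have := hind.measure_inter_preimage_eq_mul {j} {l} .of_discrete .of_discrete
      rw [measureReal_def, measureReal_def, measureReal_def, ← ENNReal.toReal_mul]
      congr 1
      convert! this using 2
      · ext ω; simp
      · congr 1; ext ω; simp
    rw [Finset.prod_insert ha, coeffs_one_add_smul_mul]
    simp_rw [Finset.sum_insert ha]
    cases k with
    | zero =>
      rw [coeffs_shiftElem_mul_zero, ← ih, ← h.real_eq_zero, mul_zero, add_zero, mul_comm, ← hmul]
      congr 1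
      ext ω
      simp [and_comm]
    | succ k =>
      rw [coeffs_shiftElem_mul_succ, ← ih, ← ih, ← h.real_eq_zero, ← h.real_eq_one, mul_comm, ← hmul,
        mul_comm, ← hmul]
      have hmeas (i) : AEMeasurable (ξ i) P := (h.law i).aemeasurable
      have hS : AEMeasurable (fun ω => ∑ i ∈ s, ξ i ω) P := by fun_prop
      rw [← measureReal_union₀]
      -- The variable `ξ a` takes values in `{0, 1}` only almost surely, so the splitting of the
      -- event holds only up to a null set.
      · refine measureReal_congr ?_
        filter_upwards [h.ae_le_one a] with ω hω
        apply propext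
        change ξ a ω + ∑ i ∈ s, ξ i ω = k + 1 ↔
          (∑ i ∈ s, ξ i ω = k + 1 ∧ ξ a ω = 0) ∨ (∑ i ∈ s, ξ i ω = k ∧ ξ a ω = 1)
        omega
      · exact (hS.nullMeasurableSet_preimage (.of_discrete (s := {k}))).inter
          ((hmeas a).nullMeasurableSet_preimage (.of_discrete (s := {1})))
      · refine Disjoint.aedisjoint (Set.disjoint_left.2 fun ω h1 h2 => ?_)
        have := h1.2.symm.trans h2.2
        omega

theorem lam_nonneg (p : Fin n → unitInterval) : 0 ≤ lam p :=
  Finset.sum_nonneg fun i _ => (p i).2.1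

theorem poissonError_singleton (h : IsIndepBernoulli P p ξ) (k : ℕ) :
    poissonError P p ξ {k} = coeffs (∏ i, (1 + (p i : ℝ) • (shiftElem - 1))
      - NormedSpace.exp (lam p • (shiftElem - 1))) k := by
  have hmeas (i) : AEMeasurable (ξ i) P := (h.law i).aemeasurable
  have hS : AEMeasurable (fun ω => ∑ i, ξ i ω) P := by fun_prop
  rw [poissonError, sub_apply, Measure.toSignedMeasure_apply_measurable .of_discrete,
    Measure.toSignedMeasure_apply_measurable .of_discrete, poissonMeasure_real_singleton,
    Real.coe_toNNReal _ (lam_nonneg p), coeffs_sub, coeffs_exp,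
    ← h.real_sum_eq, map_measureReal_apply_of_aemeasurable hS .of_discrete]
  rfl

theorem signedCDF_poissonError (h : IsIndepBernoulli P p ξ) {Q : ConvAlgebra}
    (hQ : ∏ i, (1 + (p i : ℝ) • (shiftElem - 1)) - NormedSpace.exp (lam p • (shiftElem - 1))
      = (shiftElem - 1) * Q) (j : ℕ) : signedCDF (poissonError P p ξ) j = -coeffs Q j := by
  rw [signedCDF, ← sum_coeffs_sub_one_mul, ← hQ]
  exact Finset.sum_congr rfl fun k _ => poissonError_singleton h k

theorem wassersteinNorm_poissonError (h : IsIndepBernoulli P p ξ) {Q : ConvAlgebra}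
    (hQ : ∏ i, (1 + (p i : ℝ) • (shiftElem - 1)) - NormedSpace.exp (lam p • (shiftElem - 1))
      = (shiftElem - 1) * Q) : wassersteinNorm (poissonError P p ξ) = ‖coeffs Q‖ := by
  simp_rw [wassersteinNorm, norm_summableSeq, signedCDF_poissonError h hQ, abs_neg]

theorem finiteWassersteinNorm_poissonError (h : IsIndepBernoulli P p ξ) :
    FiniteWassersteinNorm (poissonError P p ξ) := by
  obtain ⟨Q, hQ⟩ := exists_prod_one_add_sub_exp_eq_mul Finset.univ (fun i => (p i : ℝ)) (lam p)
    (shiftElem - 1)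
  simp_rw [FiniteWassersteinNorm, signedCDF_poissonError h hQ, abs_neg]
  exact summable_abs_summableSeq _

theorem le_maxProb (p : Fin n → unitInterval) (i : Fin n) : (p i : ℝ) ≤ maxProb p :=
  le_ciSup (f := fun i => (p i : ℝ)) (Set.finite_range _).bddAbove i

theorem lamTwo_nonneg (p : Fin n → unitInterval) : 0 ≤ lamTwo p :=
  Finset.sum_nonneg fun _ _ => sq_nonneg _

theorem lamTwo_pos {p : Fin n → unitInterval} (h : 0 < lam p) : 0 < lamTwo p := by
  obtain ⟨i, hi, hpi⟩ := Finset.exists_ne_zero_of_sum_ne_zero (s := Finset.univ)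
    (f := fun i => (p i : ℝ)) h.ne'
  exact Finset.sum_pos' (fun _ _ => sq_nonneg _) ⟨i, hi, by positivity⟩

/-- The Wasserstein distance to the Poisson law, with an explicit constant. -/
theorem abs_wassersteinNorm_poissonError_sub_le (h : IsIndepBernoulli P p ξ)
    (hmax : maxProb p ≤ 1 / 20) (hlam : 1 ≤ lam p) :
    |wassersteinNorm (poissonError P p ξ) - lamTwo p / √(2 * Real.pi * lam p)|
      ≤ 13 * lamTwo p / √(lam p) * (maxProb p + 1 / √(lam p)) := by
  have hl0 : 0 < lam p := by linarith
  obtain ⟨Q, hQ, hQn⟩ := exists_prod_sub_exp_eq_mul_norm_le Finset.univ (fun i => (p i : ℝ))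
    (fun i _ => (p i).2.1) (fun i _ => le_maxProb p i) hmax hlam norm_shiftElem_le
  change ‖Q + (lamTwo p / 2) • ((shiftElem - 1) * NormedSpace.exp (lam p • (shiftElem - 1)))‖
    ≤ 13 * lamTwo p / √(lam p) * maxProb p at hQn
  rw [wassersteinNorm_poissonError h hQ]
  have h2 := lamTwo_nonneg p
  set B := (lamTwo p / 2) • ((shiftElem - 1) * NormedSpace.exp (lam p • (shiftElem - 1))) with hB
  have hBn : ‖coeffs B‖ = lamTwo p * poissonWeight (lam p) ⌊lam p⌋₊ := by
    rw [hB, coeffs.map_smul, norm_smul, norm_coeffs_sub_one_mul_exp hl0,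
      Real.norm_of_nonneg (by positivity)]
    ring
  -- The leading part of `Q` is `-B`, hence the reverse triangle inequality against `-coeffs B`.
  have h3 : |‖coeffs Q‖ - ‖coeffs B‖| ≤ 13 * lamTwo p / √(lam p) * maxProb p := by
    have := abs_norm_sub_norm_le (coeffs Q) (-coeffs B)
    rw [norm_neg, sub_neg_eq_add, ← coeffs.map_add] at this
    exact this.trans ((norm_coeffs_le _).trans hQn)
  have h4 : |‖coeffs B‖ - lamTwo p / √(2 * Real.pi * lam p)|
      ≤ 13 * lamTwo p / √(lam p) * (1 / √(lam p)) := by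
    have h5 := abs_poissonWeight_floor_sub_le hlam
    rw [hBn, show lamTwo p * poissonWeight (lam p) ⌊lam p⌋₊ - lamTwo p / √(2 * Real.pi * lam p)
      = lamTwo p * (poissonWeight (lam p) ⌊lam p⌋₊ - 1 / √(2 * Real.pi * lam p)) by ring,
      abs_mul, abs_of_nonneg h2, div_mul_div_comm, Real.mul_self_sqrt hl0.le, mul_one]
    calc _ ≤ lamTwo p * (4 / lam p) := by gcongr
      _ = 4 * lamTwo p / lam p := by ring
      _ ≤ 13 * lamTwo p / lam p := by gcongr; norm_num
  calc _ ≤ _ := abs_sub_le _ ‖coeffs B‖ _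
    _ ≤ _ := add_le_add h3 h4
    _ = _ := by ring

end Law

/-! ### The asymptotic formula and its limit form. -/

theorem mainTheorem4 :
    (∃ C : ℝ, 0 < C ∧
      ∀ {Ω : Type*} [MeasurableSpace Ω] (P : Measure Ω) [IsProbabilityMeasure P]
        (n : ℕ) (p : Fin n → unitInterval) (ξ : Fin n → Ω → ℕ),
        IsIndepBernoulli P p ξ → maxProb p ≤ 1 / 20 → 1 ≤ lam p →
          FiniteWassersteinNorm (poissonError P p ξ) ∧
          |wassersteinNorm (poissonError P p ξ) - lamTwo p / √(2 * Real.pi * lam p)|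
            ≤ C * lamTwo p / √(lam p) * (maxProb p + 1 / √(lam p))) ∧
    (∀ {Ω : ℕ → Type*} [∀ n, MeasurableSpace (Ω n)] (P : ∀ n, Measure (Ω n))
        [∀ n, IsProbabilityMeasure (P n)] (N : ℕ → ℕ) (p : ∀ n, Fin (N n) → unitInterval)
        (ξ : ∀ n, Fin (N n) → Ω n → ℕ),
        (∀ n, IsIndepBernoulli (P n) (p n) (ξ n)) →
        Tendsto (fun n => maxProb (p n)) atTop (𝓝 0) →
        Tendsto (fun n => lam (p n)) atTop atTop →
          (∀ n, FiniteWassersteinNorm (poissonError (P n) (p n) (ξ n))) ∧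
          Tendsto (fun n => √(lam (p n)) / lamTwo (p n)
              * wassersteinNorm (poissonError (P n) (p n) (ξ n)))
            atTop (𝓝 (1 / √(2 * Real.pi)))) ∧
    1 / √(2 * Real.pi) ≤ 0.399 := by
  refine ⟨⟨13, by norm_num, fun P _ n p ξ h hmax hlam =>
    ⟨finiteWassersteinNorm_poissonError h, abs_wassersteinNorm_poissonError_sub_le h hmax hlam⟩⟩,
    fun P _ N p ξ h hmax hlam => ⟨fun n => finiteWassersteinNorm_poissonError (h n), ?_⟩, ?_⟩
  · have hbound : Tendsto (fun n => 13 * (maxProb (p n) + 1 / √(lam (p n)))) atTop (𝓝 0) := by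
      have h1 : Tendsto (fun n => 1 / √(lam (p n))) atTop (𝓝 0) :=
        tendsto_const_nhds.div_atTop (Real.tendsto_sqrt_atTop.comp hlam)
      simpa using (hmax.add h1).const_mul 13
    rw [tendsto_iff_dist_tendsto_zero]
    refine squeeze_zero' (.of_forall fun _ => dist_nonneg) ?_ hbound
    filter_upwards [hmax.eventually_le_const (show (0 : ℝ) < 1 / 20 by norm_num),
      hlam.eventually_ge_atTop 1] with n hn1 hn2
    have hl0 : 0 < lam (p n) := by linarith
    have hs0 : 0 < √(lam (p n)) := Real.sqrt_pos.2 hl0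
    have h20 := lamTwo_pos hl0
    have hb := abs_wassersteinNorm_poissonError_sub_le (h n) hn1 hn2
    set w := wassersteinNorm (poissonError (P n) (p n) (ξ n))
    have hpi : 0 < √(2 * Real.pi) := by positivity
    -- After this rescaling, the bound of the first part loses its prefactor and tends to zero.
    have heq : √(lam (p n)) / lamTwo (p n) * w - 1 / √(2 * Real.pi)
        = √(lam (p n)) / lamTwo (p n) * (w - lamTwo (p n) / √(2 * Real.pi * lam (p n))) := by
      rw [Real.sqrt_mul (by positivity) (lam (p n))]
      field_simp
    rw [Real.dist_eq, heq, abs_mul, abs_of_pos (by positivity)]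
    calc _ ≤ √(lam (p n)) / lamTwo (p n) *
          (13 * lamTwo (p n) / √(lam (p n)) * (maxProb (p n) + 1 / √(lam (p n)))) := by gcongr
      _ = _ := by field_simp
  · have h1 : (1 : ℝ) / 0.399 ≤ √(2 * Real.pi) := by
      apply Real.le_sqrt_of_sq_le
      -- Since `(1/0.399)² ≈ 6.2814`, the bound `π > 3.14` would not suffice.
      have := Real.pi_gt_d4
      norm_num at this ⊢
      linarith
    have hpi : 0 < √(2 * Real.pi) := by positivity
    rw [div_le_iff₀ hpi]
    rw [div_le_iff₀ (by norm_num)] at h1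
    linarith
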